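/- Let $d$ be a fixed positive integer and let $(k_n)_{n\in\mathbb N}$ be natural numbers with $k_n\to\infty$. For all $n,p\in\mathbb N$ let $\mathbf X_{n,p,1},\dots,\mathbf X_{n,p,k_n}$ be independent random vectors in $\mathbb R^d$ with mean zero and $\mathrm E\|\mathbf X_{n,p,r}\|^2<\infty$ for $1\le r\le k_n$ (for different pairs $(n,p)$ they may be defined on different probability spaces), and put $\mathbf S_{n,p}=\sum_{r=1}^{k_n}\mathbf X_{n,p,r}$. Let $\mathbf e_1,\dots,\mathbf e_d$ be the canonical basis of $\mathbb R^d$. Assume that for each $p$ there is a real $d\times d$ matrix $\boldsymbol\Sigma_p=(\sigma_{p,ij})$ such that (a) $\lim_{n\to\infty}\sup_{p\in\mathbb N}\left|\mathbf e_i^\top\mathrm{Cov}(\mathbf S_{n,p})\mathbf e_j-\sigma_{p,ij}\right|=0$ for all $1\le i,j\le d$; (b) $\sup_{p\in\mathbb N}\sigma_{p,ii}<\infty$ for all $1\le i\le d$; (c) there is $\delta>0$ such that $\lim_{n\to\infty}\sup_{p\in\mathbb N}\sum_{r=1}^{k_n}\mathrm E\left[|\mathbf e_i^\top\mathbf X_{n,p,r}|^{2+\delta}\right]=0$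 for all $1\le i\le d$. Then each $\boldsymbol\Sigma_p$ is symmetric positive semidefinite, and $\mathbf S_{n,p}\Longrightarrow N_d(\mathbf 0_d,\boldsymbol\Sigma_p)$ uniformly-over-$p$ as $n\to\infty$, that is, for every bounded continuous $f:\mathbb R^d\to\mathbb R$, $$\lim_{n\to\infty}\sup_{p\in\mathbb N}\left|\mathrm E[f(\mathbf S_{n,p})]-\int_{\mathbb R^d} f\,\mathrm dN_d(\mathbf 0_d,\boldsymbol\Sigma_p)\right|=0.$$ -/

import Mathlib

open MeasureTheory ProbabilityTheory Filter Topology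
open scoped ENNReal BoundedContinuousFunction

/-- Uniform-over-`p` weak convergence `μ n p ⟹ ν p` as `n → ∞`: for every bounded continuous
real function `f`, `sup_p |∫ f dμ_{n,p} - ∫ f dν_p| → 0`. The supremum is taken in `[0, ∞]`. -/
def UniformWeakConvergence {E : Type*} [TopologicalSpace E] [MeasurableSpace E]
    (μ : ℕ → ℕ → Measure E) (ν : ℕ → Measure E) : Prop :=
  ∀ f : E →ᵇ ℝ,
    Tendsto (fun n => ⨆ p, ENNReal.ofReal |(∫ x, f x ∂(μ n p)) - ∫ x, f x ∂(ν p)|) atTop (𝓝 0)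

/-- The row sum `X₁ + ⋯ + X_k` of `k` random vectors in `ℝ^d`. -/
noncomputable def rowSum {d k : ℕ} {Ω : Type*} (X : Fin k → Ω → EuclideanSpace ℝ (Fin d)) :
    Ω → EuclideanSpace ℝ (Fin d) :=
  fun ω => ∑ r, X r ω

/-! A supremum over `p` tends to zero as soon as the error tends to zero along every choice `n ↦ p
n` (`tendsto_iSup_zero_of_forall`), so uniformity reduces to sequences. The matrices `S p` are
limits of covariance matrices, hence positive semidefinite, and their bounded diagonals bound all
entries; along a subsequence `S (p n)` converges to some `B`. There the laws of the row sums and the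
Gaussians with covariance `S (p n)` both converge weakly to the Gaussian with covariance `B`, so
their integrals against `f` differ by `o(1)`.

Convergence of the row sums is Lyapunov's theorem, via Lévy's continuity theorem. In a fixed
direction `t` the characteristic function is a product over `r`; each factor is compared with `1 - v
r / 2` and then with `exp (-(v r / 2))`, where `v r` is the variance of the summand, and the errors
add up because all factors have norm at most one. -/

theorem norm_prod_sub_prod_le_sum {ι R : Type*} [NormedCommRing R] [NormOneClass R]
    (s : Finset ι) (a b : ι → R)
    (ha : ∀ i ∈ s, ‖a i‖ ≤ 1) (hb : ∀ i ∈ s, ‖b i‖ ≤ 1) :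
    ‖∏ i ∈ s, a i - ∏ i ∈ s, b i‖ ≤ ∑ i ∈ s, ‖a i - b i‖ := by
  classical
  induction s using Finset.induction_on with
  | empty => simp
  | insert j s hj ih =>
    rw [Finset.prod_insert hj, Finset.prod_insert hj, Finset.sum_insert hj]
    have ih' := ih (fun i hi => ha i (Finset.mem_insert_of_mem hi))
      (fun i hi => hb i (Finset.mem_insert_of_mem hi))
    have hpa : ‖∏ i ∈ s, a i‖ ≤ 1 := (s.norm_prod_le a).trans <|
      Finset.prod_le_one (fun i _ => norm_nonneg _) fun i hi => ha i (Finset.mem_insert_of_mem hi)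
    have hbj := hb j (Finset.mem_insert_self j s)
    calc ‖a j * ∏ i ∈ s, a i - b j * ∏ i ∈ s, b i‖
        = ‖(a j - b j) * ∏ i ∈ s, a i + b j * (∏ i ∈ s, a i - ∏ i ∈ s, b i)‖ := by
          congr 1; ring
      _ ≤ ‖a j - b j‖ * ‖∏ i ∈ s, a i‖ + ‖b j‖ * ‖∏ i ∈ s, a i - ∏ i ∈ s, b i‖ :=
          (norm_add_le _ _).trans (add_le_add (norm_mul_le _ _) (norm_mul_le _ _))
      _ ≤ ‖a j - b j‖ * 1 + 1 * ∑ i ∈ s, ‖a i - b i‖ := by gcongr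
      _ = _ := by ring

theorem Complex.norm_exp_mul_I_sub_taylor_two_le_cube {y : ℝ} (hy : |y| ≤ 1) :
    ‖exp (y * I) - (1 + y * I - (y : ℂ) ^ 2 / 2)‖ ≤ |y| ^ 3 := by
  have hn : ‖(y : ℂ) * I‖ = |y| := by simp
  have h := exp_bound (x := y * I) (by rwa [hn]) (n := 3) (by norm_num)
  have he : ∑ m ∈ Finset.range 3, ((y : ℂ) * I) ^ m / (m.factorial : ℂ)
      = 1 + y * I - (y : ℂ) ^ 2 / 2 := by
    simp [Finset.sum_range_succ, Nat.factorial, mul_pow]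
    ring
  rw [he, hn] at h
  refine h.trans ?_
  have : (0 : ℝ) ≤ |y| ^ 3 := by positivity
  -- The exponential remainder constant is `4 / (3! * 3) = 2 / 9`.
  norm_num [Nat.factorial]
  linarith

theorem Complex.norm_exp_mul_I_sub_taylor_two_le_sq {y : ℝ} :
    ‖exp (y * I) - (1 + y * I - (y : ℂ) ^ 2 / 2)‖ ≤ 4 * |y| ^ 2 := by
  rcases le_total |y| 1 with hy | hy
  · refine (norm_exp_mul_I_sub_taylor_two_le_cube hy).trans ?_
    have : 0 ≤ |y| ^ 2 := by positivity
    nlinarith [abs_nonneg y]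
  · calc _ ≤ ‖exp (y * I)‖ + ‖1 + y * I - (y : ℂ) ^ 2 / 2‖ := norm_sub_le _ _
      _ ≤ ‖exp (y * I)‖ + (‖(1 : ℂ)‖ + ‖y * I‖ + ‖(y : ℂ) ^ 2 / 2‖) := by
          gcongr
          exact (norm_sub_le _ _).trans (by gcongr; exact norm_add_le _ _)
      _ = 1 + (1 + |y| + |y| ^ 2 / 2) := by simp [norm_exp_ofReal_mul_I]
      _ ≤ _ := by nlinarith

theorem sq_le_rpow_of_le_abs {ε δ y : ℝ} (hε : 0 < ε) (hδ : 0 < δ) (hy : ε ≤ |y|) :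
    |y| ^ 2 ≤ ε ^ (-δ) * |y| ^ (2 + δ) := by
  have hy0 : 0 < |y| := hε.trans_le hy
  have h1 : 1 ≤ ε ^ (-δ) * |y| ^ δ := by
    rw [Real.rpow_neg hε.le, ← div_eq_inv_mul, one_le_div (by positivity)]
    exact Real.rpow_le_rpow hε.le hy hδ.le
  rw [Real.rpow_add hy0, Real.rpow_two]
  nlinarith [sq_nonneg |y|]

theorem sq_le_sq_add_rpow {ε δ : ℝ} (hε : 0 < ε) (hδ : 0 < δ) (y : ℝ) :
    y ^ 2 ≤ ε ^ 2 + ε ^ (-δ) * |y| ^ (2 + δ) := by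
  have h0 : 0 ≤ ε ^ (-δ) * |y| ^ (2 + δ) := by positivity
  rw [← sq_abs]
  rcases le_total ε |y| with h | h
  · linarith [sq_le_rpow_of_le_abs hε hδ h, sq_nonneg ε]
  · linarith [pow_le_pow_left₀ (abs_nonneg y) h 2]

/-- Below the threshold `ε` the cubic bound yields a factor `ε`; above it the quadratic bound is
absorbed by the moment of order `2 + δ`. Splitting at `ε` avoids requiring `δ ≤ 1`. -/
theorem Complex.norm_exp_mul_I_sub_taylor_two_le {ε δ : ℝ} (hε : 0 < ε) (hε1 : ε ≤ 1)
    (hδ : 0 < δ) (y : ℝ) :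
    ‖exp (y * I) - (1 + y * I - (y : ℂ) ^ 2 / 2)‖
      ≤ 4 * (ε * y ^ 2 + ε ^ (-δ) * |y| ^ (2 + δ)) := by
  have h0 : 0 ≤ ε ^ (-δ) * |y| ^ (2 + δ) := by positivity
  rcases le_total ε |y| with h | h
  · refine norm_exp_mul_I_sub_taylor_two_le_sq.trans ?_
    have := sq_le_rpow_of_le_abs hε hδ h
    nlinarith [mul_nonneg hε.le (sq_nonneg y)]
  · refine (norm_exp_mul_I_sub_taylor_two_le_cube (h.trans hε1)).trans ?_
    rw [← sq_abs]
    nlinarith [mul_nonneg hε.le (sq_nonneg |y|), mul_le_mul_of_nonneg_right h (sq_nonneg |y|)]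

theorem Real.abs_exp_neg_sub_one_sub_le {x : ℝ} (hx : 0 ≤ x) :
    |Real.exp (-x) - (1 - x)| ≤ x ^ 2 := by
  rcases le_total x 1 with h | h
  · have := Real.norm_exp_sub_one_sub_id_le (x := -x) (by simpa [abs_of_nonneg hx] using h)
    rw [show Real.exp (-x) - (1 - x) = Real.exp (-x) - 1 - -x by ring]
    simpa [abs_of_nonneg hx] using this
  · have h1 : Real.exp (-x) ≤ 1 := Real.exp_le_one_iff.2 (by linarith)
    have h2 := Real.exp_pos (-x)
    rw [abs_le]; constructor <;> nlinarith

/-! ### Quantitative Lyapunov estimate for real summands -/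

section CharFun

variable {Ω : Type*} [MeasurableSpace Ω] {P : Measure Ω} [IsProbabilityMeasure P]

theorem norm_integral_exp_mul_I_sub_le {Y : Ω → ℝ} {ε δ : ℝ} (hε : 0 < ε) (hε1 : ε ≤ 1)
    (hδ : 0 < δ) (hY : MemLp Y 2 P) (hmean : ∫ ω, Y ω ∂P = 0)
    (hint : Integrable (fun ω => |Y ω| ^ (2 + δ)) P) :
    ‖∫ ω, Complex.exp (Y ω * Complex.I) ∂P - ((1 - (∫ ω, Y ω ^ 2 ∂P) / 2 : ℝ) : ℂ)‖
      ≤ 4 * (ε * ∫ ω, Y ω ^ 2 ∂P + ε ^ (-δ) * ∫ ω, |Y ω| ^ (2 + δ) ∂P) := by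
  have hY1 : Integrable Y P := hY.integrable one_le_two
  have hY2 : Integrable (fun ω => Y ω ^ 2) P := hY.integrable_sq
  have hYC : Integrable (fun ω => (Y ω : ℂ)) P := hY1.ofReal
  have hY2C : Integrable (fun ω => (Y ω : ℂ) ^ 2) P := by
    simpa using hY2.ofReal (𝕜 := ℂ)
  have hT1 : Integrable (fun ω => 1 + (Y ω : ℂ) * Complex.I) P :=
    (integrable_const _).add (hYC.mul_const _)
  have hT : Integrable (fun ω => 1 + (Y ω : ℂ) * Complex.I - (Y ω : ℂ) ^ 2 / 2) P :=
    hT1.sub (hY2C.div_const _)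
  have hE : Integrable (fun ω => Complex.exp (Y ω * Complex.I)) P := by
    refine Integrable.of_bound (C := 1) ?_ (ae_of_all _ fun ω => ?_)
    · exact (Complex.continuous_exp.comp_aestronglyMeasurable
        (hYC.aestronglyMeasurable.mul_const _))
    · exact (Complex.norm_exp_ofReal_mul_I _).le
  have hval : ((1 - (∫ ω, Y ω ^ 2 ∂P) / 2 : ℝ) : ℂ)
      = ∫ ω, (1 + (Y ω : ℂ) * Complex.I - (Y ω : ℂ) ^ 2 / 2) ∂P := by
    rw [integral_sub hT1 (hY2C.div_const _), integral_add (integrable_const _) (hYC.mul_const _),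
      integral_mul_const, integral_div, integral_complex_ofReal, hmean]
    have : ∫ ω, (Y ω : ℂ) ^ 2 ∂P = ((∫ ω, Y ω ^ 2 ∂P : ℝ) : ℂ) := by
      rw [← integral_complex_ofReal]; simp
    rw [this]
    simp
  rw [hval, ← integral_sub hE hT]
  calc _ ≤ ∫ ω, 4 * (ε * Y ω ^ 2 + ε ^ (-δ) * |Y ω| ^ (2 + δ)) ∂P :=
        norm_integral_le_of_norm_le (((hY2.const_mul _).add (hint.const_mul _)).const_mul _)
          (ae_of_all _ fun ω => Complex.norm_exp_mul_I_sub_taylor_two_le hε hε1 hδ _)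
    _ = _ := by
      rw [integral_const_mul, integral_add (hY2.const_mul _) (hint.const_mul _),
        integral_const_mul, integral_const_mul]

theorem integral_sq_le_sq_add_rpow {Y : Ω → ℝ} {ε δ : ℝ} (hε : 0 < ε)
    (hδ : 0 < δ) (hY : MemLp Y 2 P) (hint : Integrable (fun ω => |Y ω| ^ (2 + δ)) P) :
    ∫ ω, Y ω ^ 2 ∂P ≤ ε ^ 2 + ε ^ (-δ) * ∫ ω, |Y ω| ^ (2 + δ) ∂P := by
  calc _ ≤ ∫ ω, (ε ^ 2 + ε ^ (-δ) * |Y ω| ^ (2 + δ)) ∂P :=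
        integral_mono hY.integrable_sq ((integrable_const _).add (hint.const_mul _))
          fun ω => sq_le_sq_add_rpow hε hδ _
    _ = _ := by
      rw [integral_add (integrable_const _) (hint.const_mul _), integral_const_mul]
      simp

/-- Quantitative Lyapunov central limit theorem at the level of characteristic functions. -/
theorem norm_prod_integral_exp_mul_I_sub_exp_le {ι : Type*} [Fintype ι] {Y : ι → Ω → ℝ}
    {ε δ : ℝ} (hε : 0 < ε) (hε1 : ε ≤ 1) (hδ : 0 < δ) (hY : ∀ r, MemLp (Y r) 2 P)
    (hmean : ∀ r, ∫ ω, Y r ω ∂P = 0)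
    (hint : ∀ r, Integrable (fun ω => |Y r ω| ^ (2 + δ)) P) {s L : ℝ}
    (hs : ∑ r, ∫ ω, Y r ω ^ 2 ∂P = s) (hL : ∑ r, ∫ ω, |Y r ω| ^ (2 + δ) ∂P ≤ L) :
    ‖∏ r, ∫ ω, Complex.exp (Y r ω * Complex.I) ∂P - ((Real.exp (-(s / 2)) : ℝ) : ℂ)‖
      ≤ 4 * (ε * s + ε ^ (-δ) * L) + s * (ε ^ 2 + ε ^ (-δ) * L) := by
  set v : ι → ℝ := fun r => ∫ ω, Y r ω ^ 2 ∂P with hv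
  set m : ι → ℝ := fun r => ∫ ω, |Y r ω| ^ (2 + δ) ∂P with hm
  have hv0 : ∀ r, 0 ≤ v r := fun r => integral_nonneg fun ω => sq_nonneg _
  have hm0 : ∀ r, 0 ≤ m r := fun r => integral_nonneg fun ω => by positivity
  have hc : 0 ≤ ε ^ (-δ) := by positivity
  have hexp : ((Real.exp (-(s / 2)) : ℝ) : ℂ) = ∏ r, ((Real.exp (-(v r / 2)) : ℝ) : ℂ) := by
    rw [← Complex.ofReal_prod, ← Real.exp_sum, Finset.sum_neg_distrib, ← Finset.sum_div, hs]
  have hmL : ∀ r, m r ≤ L := fun r =>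
    (Finset.single_le_sum (fun i _ => hm0 i) (Finset.mem_univ r)).trans hL
  rw [hexp]
  refine (norm_prod_sub_prod_le_sum _ _ _ (fun r _ => ?_) (fun r _ => ?_)).trans ?_
  · refine (norm_integral_le_of_norm_le_const (C := 1) (ae_of_all _ fun ω => ?_)).trans ?_
    · exact (Complex.norm_exp_ofReal_mul_I _).le
    · simp
  · rw [Complex.norm_real, Real.norm_eq_abs, abs_of_pos (Real.exp_pos _), Real.exp_le_one_iff]
    linarith [hv0 r]
  -- Passing through `1 - v r / 2`, the second error is at most `(v r / 2) ^ 2`. One factor `v r` is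
  -- kept for summation; the other is bounded uniformly in `r` by splitting at `ε`.
  calc _ ≤ ∑ r, (4 * (ε * v r + ε ^ (-δ) * m r) + v r * (ε ^ 2 + ε ^ (-δ) * L)) := by
        refine Finset.sum_le_sum fun r _ => ?_
        refine (norm_sub_le_norm_sub_add_norm_sub _ (((1 - v r / 2 : ℝ) : ℂ)) _).trans
          (add_le_add (norm_integral_exp_mul_I_sub_le hε hε1 hδ (hY r) (hmean r) (hint r)) ?_)
        rw [← Complex.ofReal_sub, Complex.norm_real, Real.norm_eq_abs, abs_sub_comm]
        refine (Real.abs_exp_neg_sub_one_sub_le (by linarith [hv0 r])).trans ?_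
        have h1 : v r ≤ ε ^ 2 + ε ^ (-δ) * m r := integral_sq_le_sq_add_rpow hε hδ (hY r) (hint r)
        have h2 : ε ^ (-δ) * m r ≤ ε ^ (-δ) * L := mul_le_mul_of_nonneg_left (hmL r) hc
        nlinarith [hv0 r]
    _ = 4 * (ε * s + ε ^ (-δ) * ∑ r, m r) + s * (ε ^ 2 + ε ^ (-δ) * L) := by
        rw [Finset.sum_add_distrib, ← Finset.sum_mul, ← Finset.mul_sum, Finset.sum_add_distrib,
          ← Finset.mul_sum, ← Finset.mul_sum, hs]
    _ ≤ _ := by gcongr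

end CharFun

/-! ### Projections of row sums onto a direction -/

section Row

variable {Ω : Type*} [MeasurableSpace Ω] {P : Measure Ω} {d : ℕ}

theorem MeasureTheory.MemLp.euclideanSpace_apply {Z : Ω → EuclideanSpace ℝ (Fin d)}
    (hZ : MemLp Z 2 P) (i : Fin d) : MemLp (fun ω => Z ω i) 2 P :=
  hZ.continuousLinearMap_comp (EuclideanSpace.proj (𝕜 := ℝ) i)

theorem EuclideanSpace.real_inner_eq_sum (x t : EuclideanSpace ℝ (Fin d)) :
    inner ℝ x t = ∑ i, t i * x i := by
  simp [PiLp.inner_apply]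

theorem variance_inner_eq_sum_covariance [IsFiniteMeasure P] {Z : Ω → EuclideanSpace ℝ (Fin d)} (hZ : MemLp Z 2 P)
    (t : EuclideanSpace ℝ (Fin d)) :
    Var[fun ω => inner ℝ (Z ω) t; P]
      = ∑ i, ∑ j, t i * t j * cov[fun ω => Z ω i, fun ω => Z ω j; P] := by
  simp_rw [EuclideanSpace.real_inner_eq_sum]
  rw [variance_fun_sum fun i => (hZ.euclideanSpace_apply i).const_mul (t i)]
  refine Finset.sum_congr rfl fun i _ => Finset.sum_congr rfl fun j _ => ?_
  rw [covariance_const_mul_left, covariance_const_mul_right]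
  ring

theorem integral_inner_const_eq_zero [IsFiniteMeasure P] {Z : Ω → EuclideanSpace ℝ (Fin d)}
    (hZ : MemLp Z 2 P) (hmean : ∫ ω, Z ω ∂P = 0) (t : EuclideanSpace ℝ (Fin d)) :
    ∫ ω, inner ℝ (Z ω) t ∂P = 0 := by
  have h := integral_inner (𝕜 := ℝ) (hZ.integrable one_le_two) t
  rw [hmean, inner_zero_right] at h
  rw [← h]
  exact integral_congr_ae (ae_of_all _ fun ω => real_inner_comm _ _)

theorem variance_inner_rowSum [IsProbabilityMeasure P] {k : ℕ} {X : Fin k → Ω → EuclideanSpace ℝ (Fin d)}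
    (hindep : iIndepFun X P) (hsq : ∀ r, MemLp (X r) 2 P) (hmean : ∀ r, ∫ ω, X r ω ∂P = 0)
    (t : EuclideanSpace ℝ (Fin d)) :
    Var[fun ω => inner ℝ (rowSum X ω) t; P] = ∑ r, ∫ ω, (inner ℝ (X r ω) t) ^ 2 ∂P := by
  have hL : ∀ r, MemLp (fun ω => inner ℝ (X r ω) t) 2 P := fun r => (hsq r).inner_const t
  have hfun : (fun ω => inner ℝ (rowSum X ω) t) = ∑ r, fun ω => inner ℝ (X r ω) t := by
    ext ω
    simp [rowSum, sum_inner]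
  rw [hfun, IndepFun.variance_sum (fun r _ => hL r)]
  · refine Finset.sum_congr rfl fun r _ => ?_
    exact variance_of_integral_eq_zero (hL r).aemeasurable
      (integral_inner_const_eq_zero (hsq r) (hmean r) t)
  · intro i _ j _ hij
    exact (hindep.indepFun hij).comp (φ := fun x => inner ℝ x t) (ψ := fun x => inner ℝ x t)
      (by fun_prop) (by fun_prop)

theorem memLp_rowSum {k : ℕ} {X : Fin k → Ω → EuclideanSpace ℝ (Fin d)}
    (hsq : ∀ r, MemLp (X r) 2 P) : MemLp (rowSum X) 2 P :=
  memLp_finsetSum _ fun r _ => hsq r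

theorem measurable_rowSum {k : ℕ} {X : Fin k → Ω → EuclideanSpace ℝ (Fin d)}
    (hX : ∀ r, Measurable (X r)) : Measurable (rowSum X) :=
  Finset.measurable_sum _ fun r _ => hX r

theorem charFun_map_rowSum {k : ℕ} {X : Fin k → Ω → EuclideanSpace ℝ (Fin d)}
    (hX : ∀ r, Measurable (X r)) (hindep : iIndepFun X P) (t : EuclideanSpace ℝ (Fin d)) :
    charFun (P.map (rowSum X)) t
      = ∏ r, ∫ ω, Complex.exp ((inner ℝ (X r ω) t : ℝ) * Complex.I) ∂P := by
  unfold rowSum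
  rw [hindep.charFun_map_fun_sum_eq_prod fun r => (hX r).aemeasurable, Finset.prod_apply]
  refine Finset.prod_congr rfl fun r _ => ?_
  rw [charFun_apply, integral_map (hX r).aemeasurable]
  exact Measurable.aestronglyMeasurable (by fun_prop)

/-- The inner product is at most `∑ |t i|` times the largest coordinate of `x`, whose power is one
term of the sum. This carries the Lyapunov condition from coordinates to every direction. -/
theorem abs_inner_rpow_le_sum {q : ℝ} (hq : 0 < q) (x t : EuclideanSpace ℝ (Fin d)) :
    |inner ℝ x t| ^ q ≤ (∑ i, |t i|) ^ q * ∑ i, |x i| ^ q := by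
  rw [EuclideanSpace.real_inner_eq_sum]
  rcases isEmpty_or_nonempty (Fin d) with h | h
  · simp [Real.zero_rpow hq.ne']
  obtain ⟨i, hi⟩ := Finite.exists_max fun i => |x i|
  have h1 : |∑ j, t j * x j| ≤ (∑ j, |t j|) * |x i| := by
    refine (Finset.abs_sum_le_sum_abs _ _).trans ?_
    rw [Finset.sum_mul]
    refine Finset.sum_le_sum fun j _ => ?_
    rw [abs_mul]
    exact mul_le_mul_of_nonneg_left (hi j) (abs_nonneg _)
  have h2 : 0 ≤ ∑ j, |t j| := Finset.sum_nonneg fun j _ => abs_nonneg _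
  calc _ ≤ ((∑ j, |t j|) * |x i|) ^ q := Real.rpow_le_rpow (abs_nonneg _) h1 hq.le
    _ = (∑ j, |t j|) ^ q * |x i| ^ q := Real.mul_rpow h2 (abs_nonneg _)
    _ ≤ _ := by
      gcongr
      exact Finset.single_le_sum (f := fun j => |x j| ^ q)
        (fun j _ => by positivity) (Finset.mem_univ i)

theorem sum_lintegral_abs_inner_rpow_le {k : ℕ} {X : Fin k → Ω → EuclideanSpace ℝ (Fin d)}
    (hX : ∀ r, Measurable (X r)) {q : ℝ} (hq : 0 < q) (t : EuclideanSpace ℝ (Fin d)) :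
    ∑ r, ∫⁻ ω, ENNReal.ofReal (|inner ℝ (X r ω) t| ^ q) ∂P
      ≤ ENNReal.ofReal ((∑ i, |t i|) ^ q)
        * ∑ i, ∑ r, ∫⁻ ω, ENNReal.ofReal (|X r ω i| ^ q) ∂P := by
  rw [Finset.sum_comm, Finset.mul_sum]
  refine Finset.sum_le_sum fun r _ => ?_
  have hm : ∀ i, Measurable fun ω => ENNReal.ofReal (|X r ω i| ^ q) := fun i => by
    have := hX r
    fun_prop
  rw [← lintegral_finsetSum _ fun i _ => hm i,
    ← lintegral_const_mul _ (Finset.measurable_sum _ fun i _ => hm i)]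
  refine lintegral_mono fun ω => ?_
  rw [← ENNReal.ofReal_sum_of_nonneg fun i _ => by positivity,
    ← ENNReal.ofReal_mul (Real.rpow_nonneg (Finset.sum_nonneg fun j _ => abs_nonneg _) _)]
  exact ENNReal.ofReal_le_ofReal (abs_inner_rpow_le_sum hq _ _)

end Row

/-- Lyapunov central limit theorem for triangular arrays, for characteristic functions at a
point `t`. -/
theorem tendsto_charFun_map_rowSum {ι : Type*} {l : Filter ι} {d : ℕ} {k : ι → ℕ}
    {Ω : ι → Type*} [∀ n, MeasurableSpace (Ω n)] {P : ∀ n, Measure (Ω n)}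
    [∀ n, IsProbabilityMeasure (P n)] {X : ∀ n, Fin (k n) → Ω n → EuclideanSpace ℝ (Fin d)}
    (hmeas : ∀ n r, Measurable (X n r)) (hindep : ∀ n, iIndepFun (X n) (P n))
    (hsq : ∀ n r, MemLp (X n r) 2 (P n)) (hmean : ∀ n r, ∫ ω, X n r ω ∂(P n) = 0)
    {t : EuclideanSpace ℝ (Fin d)} {v : ℝ}
    (hvar : Tendsto (fun n => Var[fun ω => inner ℝ (rowSum (X n) ω) t; P n]) l (𝓝 v))
    {δ : ℝ} (hδ : 0 < δ)
    (hlyap : Tendsto (fun n => ∑ r, ∫⁻ ω, ENNReal.ofReal (|inner ℝ (X n r ω) t| ^ (2 + δ)) ∂(P n))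
      l (𝓝 0)) :
    Tendsto (fun n => charFun ((P n).map (rowSum (X n))) t) l
      (𝓝 ((Real.exp (-(v / 2)) : ℝ) : ℂ)) := by
  set s : ι → ℝ := fun n => Var[fun ω => inner ℝ (rowSum (X n) ω) t; P n] with hs
  set L : ι → ℝ≥0∞ :=
    fun n => ∑ r, ∫⁻ ω, ENNReal.ofReal (|inner ℝ (X n r ω) t| ^ (2 + δ)) ∂(P n) with hL
  -- Moments of order `2 + δ` are finite only eventually; this is where their integrability comes
  -- from.
  have hLtop : ∀ᶠ n in l, L n < ⊤ := hlyap.eventually (gt_mem_nhds ENNReal.zero_lt_top)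
  have hLreal : Tendsto (fun n => (L n).toReal) l (𝓝 0) := by
    simpa [Function.comp_def] using (ENNReal.tendsto_toReal ENNReal.zero_ne_top).comp hlyap
  have hbound : ∀ ε : ℝ, 0 < ε → ε ≤ 1 → ∀ᶠ n in l,
      ‖charFun ((P n).map (rowSum (X n))) t - ((Real.exp (-(s n / 2)) : ℝ) : ℂ)‖
        ≤ 4 * (ε * s n + ε ^ (-δ) * (L n).toReal)
          + s n * (ε ^ 2 + ε ^ (-δ) * (L n).toReal) := by
    intro ε hε hε1
    filter_upwards [hLtop] with n hn
    have hfin : ∀ r, ∫⁻ ω, ENNReal.ofReal (|inner ℝ (X n r ω) t| ^ (2 + δ)) ∂(P n) < ⊤ :=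
      fun r => ENNReal.sum_lt_top.1 hn r (Finset.mem_univ r)
    have hm : ∀ r, Measurable fun ω => |inner ℝ (X n r ω) t| ^ (2 + δ) := fun r => by
      have := hmeas n r
      fun_prop
    have hint : ∀ r, Integrable (fun ω => |inner ℝ (X n r ω) t| ^ (2 + δ)) (P n) := fun r =>
      ⟨(hm r).aestronglyMeasurable, by
        rw [hasFiniteIntegral_iff_ofReal (ae_of_all _ fun ω => by positivity)]
        exact hfin r⟩
    rw [charFun_map_rowSum (hmeas n) (hindep n)]
    refine norm_prod_integral_exp_mul_I_sub_exp_le hε hε1 hδ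
      (fun r => (hsq n r).inner_const t) 
      (fun r => integral_inner_const_eq_zero (hsq n r) (hmean n r) t) hint
      (variance_inner_rowSum (hindep n) (hsq n) (hmean n) t).symm ?_
    rw [hL, ENNReal.toReal_sum fun r _ => (hfin r).ne]
    refine Finset.sum_le_sum fun r _ => ?_
    rw [integral_eq_lintegral_of_nonneg_ae (ae_of_all _ fun ω => by positivity)
      (hm r).aestronglyMeasurable]
  -- The limit in `n` is taken with `ε` fixed; only afterwards is `ε` made small.
  have hlim : ∀ ε : ℝ, Tendsto (fun n => 4 * (ε * s n + ε ^ (-δ) * (L n).toReal)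
      + s n * (ε ^ 2 + ε ^ (-δ) * (L n).toReal)) l (𝓝 (4 * (ε * v) + v * ε ^ 2)) := by
    intro ε
    have h := ((((hvar.const_mul ε).add (hLreal.const_mul (ε ^ (-δ)))).const_mul 4)).add
      (hvar.mul ((hLreal.const_mul (ε ^ (-δ))).const_add (ε ^ 2)))
    simpa using h
  have hsmall : Tendsto (fun ε : ℝ => 4 * (ε * v) + v * ε ^ 2) (𝓝[>] 0) (𝓝 0) := by
    have : Continuous fun ε : ℝ => 4 * (ε * v) + v * ε ^ 2 := by fun_prop
    simpa using (this.tendsto 0).mono_left nhdsWithin_le_nhds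
  have hdiff : Tendsto (fun n => charFun ((P n).map (rowSum (X n))) t
      - ((Real.exp (-(s n / 2)) : ℝ) : ℂ)) l (𝓝 0) := by
    rw [NormedAddGroup.tendsto_nhds_zero]
    intro η hη
    obtain ⟨ε, hεη, hε⟩ := ((hsmall.eventually (gt_mem_nhds hη)).and
      (Ioc_mem_nhdsGT (zero_lt_one (α := ℝ)))).exists
    filter_upwards [hbound ε hε.1 hε.2, (hlim ε).eventually (gt_mem_nhds hεη)] with n h1 h2
    exact h1.trans_lt h2
  have hexp : Tendsto (fun n => ((Real.exp (-(s n / 2)) : ℝ) : ℂ)) l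
      (𝓝 ((Real.exp (-(v / 2)) : ℝ) : ℂ)) := by
    have : Continuous fun x : ℝ => ((Real.exp (-(x / 2)) : ℝ) : ℂ) := by fun_prop
    exact (this.tendsto v).comp hvar
  simpa using hdiff.add hexp

/-! ### Uniform convergence through sequences -/

theorem tendsto_of_tendsto_iSup_zero {α β ι : Type*} {l : Filter α} {l' : Filter ι}
    {g : α → β → ℝ≥0∞} (hg : Tendsto (fun n => ⨆ p, g n p) l (𝓝 0)) {N : ι → α}
    (hN : Tendsto N l' l) (p : ι → β) : Tendsto (fun m => g (N m) (p m)) l' (𝓝 0) :=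
  tendsto_of_tendsto_of_tendsto_of_le_of_le tendsto_const_nhds (hg.comp hN)
    (fun _ => bot_le) fun m => le_iSup (g (N m)) (p m)

/-- For a given `ε`, choose at each `n` an index violating the bound whenever one exists;
convergence along this choice rules out violations eventually. -/
theorem tendsto_iSup_zero_of_forall {α β : Type*} [Nonempty β] {l : Filter α}
    {g : α → β → ℝ≥0∞} (hg : ∀ p : α → β, Tendsto (fun n => g n (p n)) l (𝓝 0)) :
    Tendsto (fun n => ⨆ p, g n p) l (𝓝 0) := by
  classical
  rw [ENNReal.tendsto_nhds_zero]
  intro ε hε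
  have hex : ∀ n, ∃ q, (∃ p, ε < g n p) → ε < g n q := fun n => by
    by_cases h : ∃ p, ε < g n p
    · exact ⟨h.choose, fun _ => h.choose_spec⟩
    · exact ⟨Classical.arbitrary β, fun h' => absurd h' h⟩
  choose q hq using hex
  filter_upwards [ENNReal.tendsto_nhds_zero.1 (hg q) ε hε] with n hn
  refine iSup_le fun p => ?_
  by_contra! h
  exact hn.not_gt (hq n ⟨p, h⟩)

theorem tendsto_zero_of_tendsto_ofReal_abs {α : Type*} {l : Filter α} {u : α → ℝ}
    (hu : Tendsto (fun n => ENNReal.ofReal |u n|) l (𝓝 0)) : Tendsto u l (𝓝 0) := by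
  rw [tendsto_zero_iff_abs_tendsto_zero]
  have h := (ENNReal.tendsto_toReal ENNReal.zero_ne_top).comp hu
  simpa [Function.comp_def] using h

/-! ### Positive semidefinite matrices and Gaussian limits -/

namespace Matrix

variable {n : Type*} [Fintype n]

theorem dotProduct_mulVec_eq_sum_sum (A : Matrix n n ℝ) (x : n → ℝ) :
    x ⬝ᵥ A *ᵥ x = ∑ i, ∑ j, x i * x j * A i j := by
  simp only [dotProduct, mulVec, Finset.mul_sum]
  exact Finset.sum_congr rfl fun i _ => Finset.sum_congr rfl fun j _ => by ring

theorem continuous_dotProduct_mulVec (x : n → ℝ) :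
    Continuous fun A : Matrix n n ℝ => x ⬝ᵥ A *ᵥ x := by
  fun_prop

theorem isClosed_posSemidef : IsClosed {A : Matrix n n ℝ | A.PosSemidef} := by
  have : {A : Matrix n n ℝ | A.PosSemidef}
      = {A | Aᴴ = A} ∩ ⋂ x : n → ℝ, {A | 0 ≤ x ⬝ᵥ A *ᵥ x} := by
    ext A
    simp [posSemidef_iff_dotProduct_mulVec, IsHermitian]
  rw [this]
  exact (isClosed_eq (by fun_prop) continuous_id).inter
    (isClosed_iInter fun x => isClosed_le continuous_const (continuous_dotProduct_mulVec x))

theorem PosSemidef.abs_apply_le {A : Matrix n n ℝ} (hA : A.PosSemidef) (i j : n) :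
    |A i j| ≤ (A i i + A j j) / 2 := by
  classical
  have hsymm : A j i = A i j := by simpa using hA.isHermitian.apply i j
  have key : ∀ c : ℝ, 0 ≤ A i i + 2 * c * A i j + c ^ 2 * A j j := by
    intro c
    have h := hA.dotProduct_mulVec_nonneg (Pi.single i 1 + Pi.single j c)
    simp only [star_trivial, mulVec_add, dotProduct_add, add_dotProduct, mulVec_single,
      single_dotProduct] at h
    simp [hsymm] at h
    linarith
  rw [abs_le]
  -- The quadratic form at `e_i + e_j` and `e_i - e_j` gives the two signs.
  constructor <;> linarith [key 1, key (-1)]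

end Matrix

theorem tendsto_multivariateGaussian {d : ℕ} {A : ℕ → Matrix (Fin d) (Fin d) ℝ}
    {B : Matrix (Fin d) (Fin d) ℝ} (hA : ∀ n, (A n).PosSemidef) (hAB : Tendsto A atTop (𝓝 B))
    (f : EuclideanSpace ℝ (Fin d) →ᵇ ℝ) :
    Tendsto (fun n => ∫ x, f x ∂(multivariateGaussian 0 (A n))) atTop
      (𝓝 (∫ x, f x ∂(multivariateGaussian 0 B))) := by
  have hB : B.PosSemidef := Matrix.isClosed_posSemidef.mem_of_tendsto hAB (.of_forall hA)
  refine ProbabilityMeasure.tendsto_iff_forall_integral_tendsto.1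
    (ProbabilityMeasure.tendsto_of_tendsto_charFun
      (μ := fun n => ⟨multivariateGaussian 0 (A n), inferInstance⟩)
      (μ₀ := ⟨multivariateGaussian 0 B, inferInstance⟩) fun t => ?_) f
  simp only [ProbabilityMeasure.coe_mk, charFun_multivariateGaussian (hA _),
    charFun_multivariateGaussian hB]
  have h := ((Matrix.continuous_dotProduct_mulVec (t : Fin d → ℝ)).tendsto B).comp hAB
  have hc : Continuous fun x : ℝ => Complex.exp (inner ℝ t (0 : EuclideanSpace ℝ (Fin d)) *
    Complex.I - x / 2) := by fun_prop
  exact (hc.tendsto _).comp h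

/-! ### Limits along sequences of index pairs -/

section Array

variable {d : ℕ} {k : ℕ → ℕ} {Ω : ℕ → ℕ → Type*} [∀ n p, MeasurableSpace (Ω n p)]
  {P : ∀ n p, Measure (Ω n p)}
  {X : ∀ n p, Fin (k n) → Ω n p → EuclideanSpace ℝ (Fin d)}
  {S : ℕ → Matrix (Fin d) (Fin d) ℝ}

theorem tendsto_covariance_sub
    (hcov : ∀ i j : Fin d,
      Tendsto (fun n => ⨆ p, ENNReal.ofReal
        |cov[fun ω => rowSum (X n p) ω i, fun ω => rowSum (X n p) ω j; P n p] - S p i j|)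
        atTop (𝓝 0))
    {N : ℕ → ℕ} (hN : Tendsto N atTop atTop) (p : ℕ → ℕ) (i j : Fin d) :
    Tendsto (fun m => cov[fun ω => rowSum (X (N m) (p m)) ω i,
      fun ω => rowSum (X (N m) (p m)) ω j; P (N m) (p m)] - S (p m) i j) atTop (𝓝 0) :=
  tendsto_zero_of_tendsto_ofReal_abs (tendsto_of_tendsto_iSup_zero (hcov i j) hN p)

variable [∀ n p, IsProbabilityMeasure (P n p)]

theorem tendsto_variance_inner
    (hsq : ∀ n p r, MemLp (X n p r) 2 (P n p))
    (hcov : ∀ i j : Fin d,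
      Tendsto (fun n => ⨆ p, ENNReal.ofReal
        |cov[fun ω => rowSum (X n p) ω i, fun ω => rowSum (X n p) ω j; P n p] - S p i j|)
        atTop (𝓝 0))
    {N : ℕ → ℕ} (hN : Tendsto N atTop atTop) {p : ℕ → ℕ} {B : Matrix (Fin d) (Fin d) ℝ}
    (hB : Tendsto (fun m => S (p m)) atTop (𝓝 B)) (t : EuclideanSpace ℝ (Fin d)) :
    Tendsto (fun m => Var[fun ω => inner ℝ (rowSum (X (N m) (p m)) ω) t; P (N m) (p m)]) atTop
      (𝓝 ((t : Fin d → ℝ) ⬝ᵥ B.mulVec t)) := by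
  simp_rw [variance_inner_eq_sum_covariance (memLp_rowSum (hsq _ _)),
    Matrix.dotProduct_mulVec_eq_sum_sum]
  refine tendsto_finsetSum _ fun i _ => tendsto_finsetSum _ fun j _ => Tendsto.const_mul _ ?_
  have hBij : Tendsto (fun m => S (p m) i j) atTop (𝓝 (B i j)) :=
    ((continuous_apply_apply i j).tendsto B).comp hB
  simpa using (tendsto_covariance_sub hcov hN p i j).add hBij

theorem posSemidef_of_tendsto_covariance
    (hsq : ∀ n p r, MemLp (X n p r) 2 (P n p))
    (hcov : ∀ i j : Fin d,
      Tendsto (fun n => ⨆ p, ENNReal.ofReal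
        |cov[fun ω => rowSum (X n p) ω i, fun ω => rowSum (X n p) ω j; P n p] - S p i j|)
        atTop (𝓝 0)) (q : ℕ) : (S q).PosSemidef := by
  refine .of_dotProduct_mulVec_nonneg ?_ fun x => ?_
  · ext i j
    have hij := tendsto_covariance_sub hcov tendsto_id (fun _ => q) i j
    have hji := tendsto_covariance_sub hcov tendsto_id (fun _ => q) j i
    simp only [covariance_comm (fun ω => rowSum (X _ q) ω j)] at hji
    have h := hij.sub hji
    -- The covariances cancel by symmetry, leaving the constant `S q j i - S q i j`, which must
    -- therefore be zero.
    simp only [sub_sub_sub_cancel_left, sub_zero] at h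
    have := tendsto_nhds_unique h tendsto_const_nhds
    simpa using sub_eq_zero.1 this.symm
  · have h := tendsto_variance_inner hsq hcov tendsto_id (p := fun _ => q) tendsto_const_nhds
      (WithLp.toLp 2 x)
    simpa using ge_of_tendsto' h fun m => variance_nonneg _ _

theorem tendsto_integral_map_rowSum
    (hmeas : ∀ n p r, Measurable (X n p r))
    (hindep : ∀ n p, iIndepFun (X n p) (P n p))
    (hsq : ∀ n p r, MemLp (X n p r) 2 (P n p))
    (hmean : ∀ n p r, ∫ ω, X n p r ω ∂(P n p) = 0)
    (hcov : ∀ i j : Fin d,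
      Tendsto (fun n => ⨆ p, ENNReal.ofReal
        |cov[fun ω => rowSum (X n p) ω i, fun ω => rowSum (X n p) ω j; P n p] - S p i j|)
        atTop (𝓝 0))
    {δ : ℝ} (hδ : 0 < δ)
    (hlyap : ∀ i : Fin d,
      Tendsto (fun n => ⨆ p, ∑ r : Fin (k n),
        ∫⁻ ω, ENNReal.ofReal (|X n p r ω i| ^ (2 + δ)) ∂(P n p))
        atTop (𝓝 0))
    {N : ℕ → ℕ} (hN : Tendsto N atTop atTop) {p : ℕ → ℕ} {B : Matrix (Fin d) (Fin d) ℝ}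
    (hB : Tendsto (fun m => S (p m)) atTop (𝓝 B)) (f : EuclideanSpace ℝ (Fin d) →ᵇ ℝ) :
    Tendsto (fun m => ∫ x, f x ∂((P (N m) (p m)).map (rowSum (X (N m) (p m))))) atTop
      (𝓝 (∫ x, f x ∂(multivariateGaussian 0 B))) := by
  have hBpsd : B.PosSemidef := Matrix.isClosed_posSemidef.mem_of_tendsto hB
    (.of_forall fun m => posSemidef_of_tendsto_covariance hsq hcov (p m))
  refine ProbabilityMeasure.tendsto_iff_forall_integral_tendsto.1
    (ProbabilityMeasure.tendsto_of_tendsto_charFun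
      (μ := fun m => ⟨(P (N m) (p m)).map (rowSum (X (N m) (p m))),
        Measure.isProbabilityMeasure_map (measurable_rowSum (hmeas _ _)).aemeasurable⟩)
      (μ₀ := ⟨multivariateGaussian 0 B, inferInstance⟩) fun t => ?_) f
  simp only [ProbabilityMeasure.coe_mk, charFun_multivariateGaussian hBpsd]
  have hL : Tendsto (fun m => ∑ r, ∫⁻ ω, ENNReal.ofReal
      (|inner ℝ (X (N m) (p m) r ω) t| ^ (2 + δ)) ∂(P (N m) (p m))) atTop (𝓝 0) := by
    have hsum : Tendsto (fun m => ENNReal.ofReal ((∑ i, |t i|) ^ (2 + δ)) *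
        ∑ i, ∑ r, ∫⁻ ω, ENNReal.ofReal (|X (N m) (p m) r ω i| ^ (2 + δ)) ∂(P (N m) (p m)))
        atTop (𝓝 0) := by
      have h := ENNReal.Tendsto.const_mul (a := ENNReal.ofReal ((∑ i, |t i|) ^ (2 + δ)))
        (tendsto_finsetSum Finset.univ fun i _ => tendsto_of_tendsto_iSup_zero (hlyap i) hN p)
        (Or.inr ENNReal.ofReal_ne_top)
      simpa using h
    exact tendsto_of_tendsto_of_tendsto_of_le_of_le tendsto_const_nhds hsum (fun _ => bot_le)
      fun m => sum_lintegral_abs_inner_rpow_le (hmeas _ _) (by linarith) t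
  have h := tendsto_charFun_map_rowSum (fun m => hmeas (N m) (p m)) (fun m => hindep (N m) (p m))
    (fun m => hsq (N m) (p m)) (fun m => hmean (N m) (p m))
    (tendsto_variance_inner hsq hcov hN hB t) hδ hL
  convert h using 2
  simp

end Array

theorem exists_tendsto_subseq_of_posSemidef {d : ℕ} {S : ℕ → Matrix (Fin d) (Fin d) ℝ}
    (hS : ∀ p, (S p).PosSemidef) (hbdd : ∀ i : Fin d, BddAbove (Set.range fun p => S p i i))
    (p : ℕ → ℕ) : ∃ B, ∃ ms : ℕ → ℕ, StrictMono ms ∧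
      Tendsto (fun m => S (p (ms m))) atTop (𝓝 B) := by
  choose C hC using hbdd
  have hK : IsCompact {A : Fin d → Fin d → ℝ |
      ∀ i j, A i j ∈ Set.Icc (-((C i + C j) / 2)) ((C i + C j) / 2)} := by
    have := isCompact_univ_pi fun i : Fin d => isCompact_univ_pi fun j : Fin d =>
      isCompact_Icc (a := -((C i + C j) / 2)) (b := (C i + C j) / 2)
    simpa [Set.pi] using this
  obtain ⟨B, -, ms, hms, hlim⟩ := hK.tendsto_subseq (x := fun m i j => S (p m) i j) fun m i j => by
    have hi := hC i ⟨p m, rfl⟩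
    have hj := hC j ⟨p m, rfl⟩
    exact abs_le.1 (((hS (p m)).abs_apply_le i j).trans (by simp only at hi hj; linarith))
  exact ⟨B, ms, hms, hlim⟩

theorem corollary1 (d : ℕ) (k : ℕ → ℕ) (hk : Tendsto k atTop atTop)
    (Ω : ℕ → ℕ → Type*) [∀ n p, MeasurableSpace (Ω n p)]
    (P : ∀ n p, Measure (Ω n p)) [∀ n p, IsProbabilityMeasure (P n p)]
    (X : ∀ n p, Fin (k n) → Ω n p → EuclideanSpace ℝ (Fin d))
    (hmeas : ∀ n p r, Measurable (X n p r))
    (hindep : ∀ n p, iIndepFun (X n p) (P n p))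
    (hsq : ∀ n p r, MemLp (X n p r) 2 (P n p))
    (hmean : ∀ n p r, ∫ ω, X n p r ω ∂(P n p) = 0)
    (S : ℕ → Matrix (Fin d) (Fin d) ℝ)
    (hcov : ∀ i j : Fin d,
      Tendsto (fun n => ⨆ p, ENNReal.ofReal
        |cov[fun ω => rowSum (X n p) ω i, fun ω => rowSum (X n p) ω j; P n p] - S p i j|)
        atTop (𝓝 0))
    (hbdd : ∀ i : Fin d, BddAbove (Set.range fun p => S p i i))
    (δ : ℝ) (hδ : 0 < δ)
    (hlyap : ∀ i : Fin d,
      Tendsto (fun n => ⨆ p, ∑ r : Fin (k n),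
        ∫⁻ ω, ENNReal.ofReal (|X n p r ω i| ^ (2 + δ)) ∂(P n p))
        atTop (𝓝 0)) :
    (∀ p, (S p).PosSemidef) ∧
      UniformWeakConvergence (fun n p => (P n p).map (rowSum (X n p)))
        (fun p => multivariateGaussian 0 (S p)) := by
  have hS := posSemidef_of_tendsto_covariance hsq hcov
  refine ⟨hS, fun f => tendsto_iSup_zero_of_forall fun p => ?_⟩
  -- It suffices that every sequence `N` tending to infinity has a subsequence along which the error
  -- vanishes; compactness supplies it.
  refine tendsto_of_subseq_tendsto fun N hN => ?_
  obtain ⟨B, ms, hms, hB⟩ := exists_tendsto_subseq_of_posSemidef hS hbdd fun m => p (N m)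
  refine ⟨ms, ?_⟩
  have h := (tendsto_integral_map_rowSum hmeas hindep hsq hmean hcov hδ hlyap
    (hN.comp hms.tendsto_atTop) hB f).sub (tendsto_multivariateGaussian (fun m => hS _) hB f)
  rw [sub_self] at h
  simpa using ENNReal.tendsto_ofReal h.abs
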